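/- Let $p=3$, let $m\ge 1$ be an integer, $q=p^m$, and let $\mathbb F_q$ be the field with $q$ elements. Let $M_5$ be the number of solutions $(x_1,\dots,x_5)\in\mathbb F_q^5$ of the system \[ \sum_{i=1}^5 x_i^2=0,\qquad \sum_{i=1}^5 x_i^{p+1}=0,\qquad \sum_{i=1}^5 x_i^{p^2+1}=0 . \] Then \[ M_5=5\,(p^m-1)\,(8p^m-2p-10)+1 . \] Moreover, for $\alpha,\beta,\gamma\in\mathbb F_q$ put \[ S(\alpha,\beta,\gamma)=\sum_{x\in\mathbb F_q}\zeta_p^{\operatorname{Tr}(\alpha x^2+\beta x^{p+1}+\gamma x^{p^2+1})}, \] where $\zeta_p=e^{2\pi i/p}$ and $\operatorname{Tr}:\mathbb F_q\to\mathbb F_p$ is the trace map. Then \[ \sum_{\alpha,\beta,\gamma\in\mathbb F_q}S(\alpha,\beta,\gamma)^5=M_5\cdot p^{3m}. \] -/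

import Mathlib

/-- The solutions in `F⁵` of the system
`∑ xᵢ ^ 2 = ∑ xᵢ ^ (p + 1) = ∑ xᵢ ^ (p ^ 2 + 1) = 0`. -/
def solutionSet (p : ℕ) (F : Type*) [Field F] : Set (Fin 5 → F) :=
  {x | ∑ i, x i ^ 2 = 0 ∧ ∑ i, x i ^ (p + 1) = 0 ∧ ∑ i, x i ^ (p ^ 2 + 1) = 0}

/-- The number of solutions in `F⁵` of the system. -/
noncomputable def M5 (p : ℕ) (F : Type*) [Field F] : ℕ :=
  (solutionSet p F).ncard

/-- The exponential sum
`S(α, β, γ) = ∑ x, ζ_p ^ Tr(α x ^ 2 + β x ^ (p + 1) + γ x ^ (p ^ 2 + 1))`, where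
`ζ_p = exp(2πi/p)` and `Tr` is the trace from `F` to the prime field `ℤ/pℤ`. -/
noncomputable def expSum (p : ℕ) {F : Type*} [Field F] [Fintype F] [Algebra (ZMod p) F]
    (α β γ : F) : ℂ :=
  ∑ x : F, Complex.exp (2 * Real.pi * Complex.I / p) ^
    (Algebra.trace (ZMod p) F (α * x ^ 2 + β * x ^ (p + 1) + γ * x ^ (p ^ 2 + 1))).val

/-! For a solution `x`, the equations and their cubes make the span of `x`, `x ^ 3`, `x ^ 9` totally
isotropic in `F ^ 5`, so these vectors are dependent (`exists_linearized_relation`). All coordinates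
of `x` are then roots of one additive polynomial of degree at most `9`, so they span at most a plane
over `𝔽₃`, and `x = u a + v b` with `u`, `v` over `𝔽₃`. For independent `a`, `b`, such an `x` is a
solution iff `u`, `v` span an isotropic subspace (`isotropic_of_combo_mem`,
`combo_mem_solutionSet`). With `q = |F|`, the zero vector, 40 points and 40 lines of the quadric
contribute `1 + 40(q - 1) + 40(q - 1)(q - 3)`. The moment identity is orthogonality of characters.
-/

open Finset Matrix

/-! ### Fifth moment of the exponential sum -/

section CharacterSum

theorem exp_two_pi_I_div_three_pow : Complex.exp (2 * Real.pi * Complex.I / (3 : ℕ)) ^ 3 = 1 :=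
  (Complex.isPrimitiveRoot_exp 3 (by norm_num)).pow_eq_one

/-- The additive character `x ↦ ζ₃ ^ Tr x` of `F`. -/
noncomputable def traceChar (F : Type*) [Field F] [Algebra (ZMod 3) F] : AddChar F ℂ :=
  (AddChar.zmodChar 3 exp_two_pi_I_div_three_pow).compAddMonoidHom
    (Algebra.trace (ZMod 3) F).toAddMonoidHom

theorem traceChar_apply {F : Type*} [Field F] [Algebra (ZMod 3) F] (x : F) : traceChar F x =
    Complex.exp (2 * Real.pi * Complex.I / (3 : ℕ)) ^ (Algebra.trace (ZMod 3) F x).val :=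
  AddChar.zmodChar_apply exp_two_pi_I_div_three_pow _

variable {F : Type*} [Field F] [Fintype F] [Algebra (ZMod 3) F]

theorem traceChar_isPrimitive : (traceChar F).IsPrimitive := by
  refine AddChar.IsPrimitive.of_ne_one fun h => ?_
  obtain ⟨x, hx⟩ := Algebra.trace_surjective (ZMod 3) F 1
  have h1 := DFunLike.congr_fun h x
  rw [traceChar_apply, hx, AddChar.one_apply, ZMod.val_one, pow_one] at h1
  exact (Complex.isPrimitiveRoot_exp 3 (by norm_num)).ne_one (by norm_num) h1

theorem expSum_pow_five (α β γ : F) : expSum 3 α β γ ^ 5 =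
    ∑ x : Fin 5 → F, traceChar F (α * ∑ i, x i ^ 2) * traceChar F (β * ∑ i, x i ^ (3 + 1)) *
      traceChar F (γ * ∑ i, x i ^ (3 ^ 2 + 1)) := by
  simp only [expSum, ← traceChar_apply]
  rw [Fintype.sum_pow]
  refine sum_congr rfl fun x _ => ?_
  simp only [← AddChar.map_add_eq_mul, Fin.prod_univ_five, Fin.sum_univ_five]
  congr 1
  ring

theorem sum_expSum_pow_five : ∑ α : F, ∑ β : F, ∑ γ : F, expSum 3 α β γ ^ 5 =
    (M5 3 F : ℂ) * (Fintype.card F : ℂ) ^ 3 := by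
  classical
  have key (b : F) : ∑ x, traceChar F (x * b) = if b = 0 then (Fintype.card F : ℂ) else 0 := by
    rw [AddChar.sum_mulShift b traceChar_isPrimitive]; split_ifs <;> simp
  calc ∑ α : F, ∑ β : F, ∑ γ : F, expSum 3 α β γ ^ 5
      = ∑ x : Fin 5 → F, (∑ α, traceChar F (α * ∑ i, x i ^ 2)) *
          (∑ β, traceChar F (β * ∑ i, x i ^ (3 + 1))) *
          ∑ γ, traceChar F (γ * ∑ i, x i ^ (3 ^ 2 + 1)) := by
        simp only [expSum_pow_five]
        simp only [sum_comm (s := (univ : Finset F)) (t := (univ : Finset (Fin 5 → F)))]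
        refine sum_congr rfl fun x _ => ?_
        simp only [← mul_sum, ← sum_mul]
    _ = ∑ x : Fin 5 → F, if x ∈ solutionSet 3 F then (Fintype.card F : ℂ) ^ 3 else 0 := by
        refine sum_congr rfl fun x _ => ?_
        simp only [key]
        by_cases hx : x ∈ solutionSet 3 F
        · rw [if_pos hx, if_pos hx.1, if_pos hx.2.1, if_pos hx.2.2]
          ring
        · rw [if_neg hx]
          split_ifs with h1 h2 h3
          · exact absurd ⟨h1, h2, h3⟩ hx
          all_goals ring
    _ = (M5 3 F : ℂ) * (Fintype.card F : ℂ) ^ 3 := by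
        rw [← sum_filter, sum_const, nsmul_eq_mul, M5, Set.ncard_eq_toFinset_card']
        congr 3
        ext x
        simp

end CharacterSum

/-! ### Points and lines of the quadric over `𝔽₃` -/

section RationalQuadric

/-- The first nonzero entry of `u` is a `1` in position `i`. -/
def LeadsAt (u : Fin 5 → ZMod 3) (i : Fin 5) : Prop := u i = 1 ∧ ∀ k < i, u k = 0

instance (u : Fin 5 → ZMod 3) (i : Fin 5) : Decidable (LeadsAt u i) :=
  inferInstanceAs (Decidable (_ ∧ _))

/-- The points of the quadric `∑ xᵢ ^ 2 = 0` in `ℙ⁴(𝔽₃)`, by normalized representatives. -/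
def isoPoints : Finset (Fin 5 → ZMod 3) := {u | (∃ i, LeadsAt u i) ∧ u ⬝ᵥ u = 0}

/-- The lines on the quadric `∑ xᵢ ^ 2 = 0` in `ℙ⁴(𝔽₃)`, by reduced row echelon bases. -/
def isoLines : Finset ((Fin 5 → ZMod 3) × (Fin 5 → ZMod 3)) :=
  {w ∈ isoPoints ×ˢ isoPoints |
    (∃ i j, i < j ∧ LeadsAt w.1 i ∧ LeadsAt w.2 j ∧ w.1 j = 0) ∧ w.1 ⬝ᵥ w.2 = 0}

set_option maxRecDepth 100000 in
-- The parabolic quadric in `ℙ⁴(𝔽₃)` has `(3 + 1)(3 ^ 2 + 1)` points, and as many lines.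
theorem card_isoPoints : #isoPoints = 40 := by decide +kernel

set_option maxRecDepth 100000 in
theorem card_isoLines : #isoLines = 40 := by decide +kernel

theorem mem_isoPoints {u : Fin 5 → ZMod 3} :
    u ∈ isoPoints ↔ (∃ i, LeadsAt u i) ∧ u ⬝ᵥ u = 0 := by
  simp [isoPoints]

theorem mem_isoLines {u v : Fin 5 → ZMod 3} : (u, v) ∈ isoLines ↔
    (∃ i j, i < j ∧ LeadsAt u i ∧ LeadsAt v j ∧ u j = 0) ∧
      u ⬝ᵥ u = 0 ∧ u ⬝ᵥ v = 0 ∧ v ⬝ᵥ v = 0 := by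
  simp only [isoLines, mem_filter, mem_product, mem_isoPoints]
  constructor
  · tauto
  · rintro ⟨⟨i, j, hij, hu, hv, h⟩, h1, h2, h3⟩
    exact ⟨⟨⟨⟨i, hu⟩, h1⟩, ⟨j, hv⟩, h3⟩, ⟨i, j, hij, hu, hv, h⟩, h2⟩

attribute [irreducible] isoPoints isoLines

end RationalQuadric

/-! ### Isotropy and linearized polynomials -/

section Solutions

theorem mem_solutionSet {F : Type*} [Field F] {x : Fin 5 → F} : x ∈ solutionSet 3 F ↔
    x ⬝ᵥ x = 0 ∧ x ⬝ᵥ (fun i => x i ^ 3) = 0 ∧ x ⬝ᵥ (fun i => (x i ^ 3) ^ 3) = 0 := by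
  simp only [solutionSet, Set.mem_ofPred_eq, dotProduct]
  ring_nf

variable {F : Type*} [Field F] [Algebra (ZMod 3) F]

theorem charP_three (F : Type*) [Field F] [Algebra (ZMod 3) F] : CharP F 3 :=
  charP_of_injective_algebraMap (algebraMap (ZMod 3) F).injective 3

theorem smul_cube (s : ZMod 3) (a : F) : (s • a) ^ 3 = s • a ^ 3 := by
  rw [smul_pow, ZMod.pow_card]

theorem add_cube (a b : F) : (a + b) ^ 3 = a ^ 3 + b ^ 3 :=
  haveI := charP_three F
  add_pow_char a b 3

theorem sum_cube {ι : Type*} (s : Finset ι) (f : ι → F) :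
    (∑ i ∈ s, f i) ^ 3 = ∑ i ∈ s, f i ^ 3 :=
  haveI := charP_three F
  sum_pow_char 3 s f

theorem combo_cube (s t : ZMod 3) (a b : F) :
    (s • a + t • b) ^ 3 = s • a ^ 3 + t • b ^ 3 := by
  rw [add_cube, smul_cube, smul_cube]

theorem combo_dotProduct (u v : Fin 5 → ZMod 3) (a b c d : F) :
    (fun i => u i • a + v i • b) ⬝ᵥ (fun i => u i • c + v i • d) =
      (u ⬝ᵥ u) • (a * c) + (u ⬝ᵥ v) • (a * d + b * c) + (v ⬝ᵥ v) • (b * d) := by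
  simp only [dotProduct, Fin.sum_univ_five, Algebra.smul_def, map_add, map_mul]
  ring

theorem combo_mem_solutionSet {u v : Fin 5 → ZMod 3} (huu : u ⬝ᵥ u = 0) (huv : u ⬝ᵥ v = 0)
    (hvv : v ⬝ᵥ v = 0) (a b : F) : (fun i => u i • a + v i • b) ∈ solutionSet 3 F := by
  rw [mem_solutionSet]
  simp only [combo_cube, combo_dotProduct, huu, huv, hvv, zero_smul, add_zero, and_self]

theorem combo_eq_zero {a b : F} (ha : a ≠ 0) (hb : ∀ s : ZMod 3, b ≠ s • a) {s t : ZMod 3}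
    (h : s • a + t • b = 0) : s = 0 ∧ t = 0 := by
  have ht : t = 0 := by
    by_contra ht
    apply hb (-(t⁻¹ * s))
    rw [neg_smul, mul_smul, ← smul_neg, neg_eq_of_add_eq_zero_right h, smul_smul,
      inv_mul_cancel₀ ht, one_smul]
  subst ht
  simpa [ha] using h

theorem combo_injective {a b : F} (ha : a ≠ 0) (hb : ∀ s : ZMod 3, b ≠ s • a)
    {s t s' t' : ZMod 3} (h : s • a + t • b = s' • a + t' • b) : s = s' ∧ t = t' := by
  have := combo_eq_zero ha hb (s := s - s') (t := t - t') (by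
    rw [sub_smul, sub_smul]; linear_combination h)
  exact ⟨sub_eq_zero.1 this.1, sub_eq_zero.1 this.2⟩

/-- The Moore determinant of two elements independent over `𝔽₃` does not vanish. -/
theorem moore_det_ne_zero {a b : F} (ha : a ≠ 0) (hb : ∀ s : ZMod 3, b ≠ s • a) :
    a * b ^ 3 - a ^ 3 * b ≠ 0 := by
  have h0 : b ≠ 0 := by simpa using hb 0
  have h1 : b - a ≠ 0 := by simpa [sub_eq_zero] using hb 1
  have h2 : b + a ≠ 0 := by simpa [← add_eq_zero_iff_eq_neg] using hb (-1)
  have : a * b ^ 3 - a ^ 3 * b = a * b * (b - a) * (b + a) := by ring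
  rw [this]
  exact mul_ne_zero (mul_ne_zero (mul_ne_zero ha h0) h1) h2

theorem isotropic_of_combo_mem {u v : Fin 5 → ZMod 3} {a b : F} (ha : a ≠ 0)
    (hb : ∀ s : ZMod 3, b ≠ s • a) (h : (fun i => u i • a + v i • b) ∈ solutionSet 3 F) :
    u ⬝ᵥ u = 0 ∧ u ⬝ᵥ v = 0 ∧ v ⬝ᵥ v = 0 := by
  rw [mem_solutionSet] at h
  simp only [combo_cube, combo_dotProduct] at h
  obtain ⟨h1, h2, -⟩ := h
  have h3 := congrArg (· ^ 3) h1
  simp only [add_cube, smul_cube, ne_eq, OfNat.ofNat_ne_zero, not_false_eq_true, zero_pow] at h3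
  simp only [Algebra.smul_def] at h1 h2 h3
  have hd := pow_ne_zero 2 (moore_det_ne_zero ha hb)
  have inj (s : ZMod 3) (hs : (a * b ^ 3 - a ^ 3 * b) ^ 2 * algebraMap (ZMod 3) F s = 0) :
      s = 0 := by
    simpa [hd] using hs
  refine ⟨inj _ ?_, inj _ ?_, inj _ ?_⟩
  -- With `D = a b³ - a³ b`, one has `D u = b³ x - b x³` and `D v = a x³ - a³ x`; the coefficients
  -- come from expanding the dot products of these vectors.
  · linear_combination b ^ 6 * h1 - 2 * b ^ 4 * h2 + b ^ 2 * h3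
  · linear_combination (-(a ^ 3 * b ^ 3)) * h1 + (a * b ^ 3 + a ^ 3 * b) * h2 - a * b * h3
  · linear_combination a ^ 6 * h1 - 2 * a ^ 4 * h2 + a ^ 2 * h3

/-- `x`, `x ^ 3` and `x ^ 9` span a totally isotropic subspace of `F ^ 5`, hence are dependent. -/
theorem exists_linearized_relation {x : Fin 5 → F} (hx : x ∈ solutionSet 3 F) :
    ∃ c : Fin 3 → F, c ≠ 0 ∧ ∀ i, c 0 * x i + c 1 * x i ^ 3 + c 2 * (x i ^ 3) ^ 3 = 0 := by
  rw [mem_solutionSet] at hx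
  obtain ⟨h1, h2, h3⟩ := hx
  have frob {y z : Fin 5 → F} (h : y ⬝ᵥ z = 0) :
      (fun i => y i ^ 3) ⬝ᵥ (fun i => z i ^ 3) = 0 := by
    have := congrArg (· ^ 3) h
    simpa [dotProduct, sum_cube, mul_pow] using this
  set M : Matrix (Fin 3) (Fin 5) F := ![x, fun i => x i ^ 3, fun i => (x i ^ 3) ^ 3] with hM
  have hMM : M * Mᵀ = 0 := by
    ext i j
    change M i ⬝ᵥ M j = 0
    fin_cases i <;> fin_cases j
    exacts [h1, h2, h3, (dotProduct_comm _ _).trans h2, frob h1, frob h2,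
      (dotProduct_comm _ _).trans h3, (dotProduct_comm _ _).trans (frob h2), frob (frob h1)]
  -- Independent rows would give `3 + 3 ≤ 5`.
  have hnot : ¬ LinearIndependent F M.row := fun hli => by
    have := rank_add_rank_le_card_of_mul_eq_zero hMM
    rw [rank_transpose, hli.rank_matrix] at this
    simp at this
  rw [Fintype.not_linearIndependent_iff] at hnot
  obtain ⟨c, hc, k, hk⟩ := hnot
  refine ⟨c, fun h => hk (by simp [h]), fun i => ?_⟩
  have := congrFun hc i
  simpa [Fin.sum_univ_three, hM, Matrix.row] using this

open Polynomial in
/-- The roots of a nonzero additive polynomial of degree at most `9` that has two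
`𝔽₃`-independent roots are the combinations of these. -/
theorem exists_combo_of_linearized {c : Fin 3 → F} (hc : c ≠ 0) {a b z : F} (ha : a ≠ 0)
    (hb : ∀ s : ZMod 3, b ≠ s • a) (ra : c 0 * a + c 1 * a ^ 3 + c 2 * (a ^ 3) ^ 3 = 0)
    (rb : c 0 * b + c 1 * b ^ 3 + c 2 * (b ^ 3) ^ 3 = 0)
    (rz : c 0 * z + c 1 * z ^ 3 + c 2 * (z ^ 3) ^ 3 = 0) :
    ∃ s t : ZMod 3, z = s • a + t • b := by
  classical
  by_contra! hz
  set P : F[X] := C (c 0) * X + C (c 1) * X ^ 3 + C (c 2) * X ^ 9 with hP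
  have hP0 : P ≠ 0 := fun h => hc <| by
    have e0 := congrArg (coeff · 1) h
    have e1 := congrArg (coeff · 3) h
    have e2 := congrArg (coeff · 9) h
    simp [hP, coeff_X_pow] at e0 e1 e2
    ext i; fin_cases i <;> simp [e0, e1, e2]
  have hdeg : P.natDegree ≤ 9 := by
    rw [hP]; compute_degree
  let f : ZMod 3 × ZMod 3 → F := fun w => w.1 • a + w.2 • b
  have hf : Function.Injective f := fun w w' h => Prod.ext_iff.2 (combo_injective ha hb h)
  -- The nine combinations of `a`, `b` together with `z` would be ten roots.
  have hsub : insert z (univ.image f) ⊆ P.roots.toFinset := by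
    intro y hy
    rw [Multiset.mem_toFinset, mem_roots hP0, IsRoot]
    rw [mem_insert, mem_image] at hy
    simp only [hP, eval_add, eval_mul, eval_C, eval_X, eval_pow]
    rcases hy with rfl | ⟨⟨s, t⟩, -, rfl⟩
    · linear_combination rz
    · rw [show 9 = 3 * 3 from rfl, pow_mul]
      simp only [f, combo_cube]
      simp only [Algebra.smul_def]
      linear_combination algebraMap (ZMod 3) F s * ra + algebraMap (ZMod 3) F t * rb
  have h1 := card_le_card hsub
  rw [card_insert_of_notMem (by
    rw [mem_image]; rintro ⟨⟨s, t⟩, -, h⟩; exact hz s t h.symm), card_image_of_injective _ hf] at h1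
  have h2 := (Multiset.toFinset_card_le P.roots).trans (P.card_roots'.trans hdeg)
  simp [ZMod.card] at h1
  omega

end Solutions

/-! ### Normal form of a solution and its uniqueness -/

section Classification

theorem exists_first {p : Fin 5 → Prop} (h : ∃ i, p i) : ∃ i, p i ∧ ∀ k < i, ¬ p k := by
  obtain ⟨i, hi, hmin⟩ := wellFounded_lt.has_min {i | p i} h
  exact ⟨i, hi, fun k hk hp => hmin k hp hk⟩

theorem first_unique {p : Fin 5 → Prop} {i j : Fin 5} (hi : p i) (hi' : ∀ k < i, ¬ p k)
    (hj : p j) (hj' : ∀ k < j, ¬ p k) : i = j :=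
  le_antisymm (not_lt.1 fun h => hi' j h hj) (not_lt.1 fun h => hj' i h hi)

theorem lead_unique {F : Type*} [Field F] {x : Fin 5 → F} {i i' : Fin 5} {a a' : F}
    (ha : a ≠ 0) (ha' : a' ≠ 0)
    (h : x i = a ∧ ∀ k < i, x k = 0) (h' : x i' = a' ∧ ∀ k < i', x k = 0) : i = i' ∧ a = a' := by
  have : i = i' := first_unique (p := fun k => x k ≠ 0)
    (h.1 ▸ ha) (fun k hk => not_not.2 (h.2 k hk)) (h'.1 ▸ ha')
    (fun k hk => not_not.2 (h'.2 k hk))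
  subst this
  exact ⟨rfl, h.1.symm.trans h'.1⟩

variable {F : Type*} [Field F] [Algebra (ZMod 3) F]

/-- Taking `a` as the first nonzero coordinate, and `b` as the first one outside `𝔽₃ a` if any,
forces the coefficient vectors into reduced echelon form. -/
theorem solution_cases {x : Fin 5 → F} (hx : x ∈ solutionSet 3 F) :
    x = 0 ∨ (∃ u ∈ isoPoints, ∃ a : F, a ≠ 0 ∧ x = fun i => u i • a) ∨
      ∃ u v, (u, v) ∈ isoLines ∧ ∃ a b : F, a ≠ 0 ∧ (∀ s : ZMod 3, b ≠ s • a) ∧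
        x = fun i => u i • a + v i • b := by
  by_cases h0 : x = 0
  · exact Or.inl h0
  right
  obtain ⟨i, ha, hi⟩ := exists_first (Function.ne_iff.1 h0)
  simp only [Pi.zero_apply, not_not] at ha hi
  set a := x i with ha_def
  by_cases h1 : ∀ k, ∃ s : ZMod 3, x k = s • a
  · left
    choose u hu using h1
    have hu0 (k) (hk : x k = 0) : u k = 0 := by
      have := hu k
      rw [hk] at this
      simpa [ha] using this.symm
    have hui : u i = 1 := by
      have := hu i
      rw [← ha_def, eq_comm, ← sub_eq_zero] at this
      nth_rewrite 2 [← one_smul (ZMod 3) a] at this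
      rw [← sub_smul, smul_eq_zero_iff_left ha, sub_eq_zero] at this
      exact this
    refine ⟨u, mem_isoPoints.2 ⟨⟨i, hui, fun k hk => hu0 k (hi k hk)⟩, ?_⟩, a, ha, funext hu⟩
    have h := (mem_solutionSet.1 hx).1
    rw [funext hu] at h
    have h' := combo_dotProduct u 0 a 0 a 0
    simp only [smul_zero, add_zero, mul_zero, dotProduct_zero, zero_smul, h] at h'
    simpa [ha] using h'.symm
  · right
    push Not at h1
    obtain ⟨j, hb, hj⟩ := exists_first h1
    simp only [not_forall, not_not] at hj
    set b := x j with hb_def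
    obtain ⟨c, hc, hrel⟩ := exists_linearized_relation hx
    have h2 (k) : ∃ s t : ZMod 3, x k = s • a + t • b :=
      exists_combo_of_linearized hc ha hb (hrel i) (hrel j) (hrel k)
    choose u v huv using h2
    have coords {k} {s t : ZMod 3} (h : x k = s • a + t • b) : u k = s ∧ v k = t :=
      combo_injective ha hb ((huv k).symm.trans h)
    have hij : i < j := by
      by_contra hle
      rcases (not_lt.1 hle).eq_or_lt with h | h
      · exact hb 1 (by rw [hb_def, h, one_smul])
      · exact hb 0 (by rw [hb_def, hi j h, zero_smul])
    obtain ⟨hui, -⟩ := coords (k := i) (s := 1) (t := 0) (by simp [ha_def])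
    obtain ⟨huj, hvj⟩ := coords (k := j) (s := 0) (t := 1) (by simp [hb_def])
    refine ⟨u, v, mem_isoLines.2 ⟨⟨i, j, hij, ⟨hui, fun k hk => ?_⟩, ⟨hvj, fun k hk => ?_⟩, huj⟩,
      ?_⟩, a, b, ha, hb, funext huv⟩
    · exact (coords (s := 0) (t := 0) (by simp [hi k hk])).1
    · obtain ⟨s, hs⟩ := hj k hk
      exact (coords (s := s) (t := 0) (by simp [hs])).2
    · exact isotropic_of_combo_mem ha hb (funext huv ▸ hx)

theorem combo_apply_lead {u v : Fin 5 → ZMod 3} {i j : Fin 5} (hij : i < j) (hu : LeadsAt u i)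
    (hv : LeadsAt v j) (a b : F) : u i • a + v i • b = a ∧ ∀ k < i, u k • a + v k • b = 0 := by
  refine ⟨by simp [hu.1, hv.2 i hij], fun k hk => by simp [hu.2 k hk, hv.2 k (hk.trans hij)]⟩

theorem point_param_injective {u u' : Fin 5 → ZMod 3} (hu : u ∈ isoPoints) (hu' : u' ∈ isoPoints)
    {a a' : F} (ha : a ≠ 0) (ha' : a' ≠ 0)
    (h : (fun i => u i • a) = fun i => u' i • a') : u = u' ∧ a = a' := by
  obtain ⟨⟨i, hi⟩, -⟩ := mem_isoPoints.1 hu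
  obtain ⟨⟨i', hi'⟩, -⟩ := mem_isoPoints.1 hu'
  obtain ⟨rfl, rfl⟩ := lead_unique (x := fun i => u i • a) ha ha'
    (i := i) ⟨by simp [hi.1], fun k hk => by simp [hi.2 k hk]⟩
    ⟨(congrFun h i').trans (by simp [hi'.1]),
      fun k hk => (congrFun h k).trans (by simp [hi'.2 k hk])⟩
  exact ⟨funext fun k => smul_left_injective _ ha (congrFun h k), rfl⟩

theorem line_param_ne_point_param {u v u' : Fin 5 → ZMod 3} (huv : (u, v) ∈ isoLines)
    (hu' : u' ∈ isoPoints) {a b a' : F} (ha : a ≠ 0) (hb : ∀ s : ZMod 3, b ≠ s • a)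
    (ha' : a' ≠ 0) : (fun i => u i • a + v i • b) ≠ fun i => u' i • a' := by
  intro h
  obtain ⟨⟨i, j, hij, hu, hv, huj⟩, -⟩ := mem_isoLines.1 huv
  obtain ⟨⟨i', hi'⟩, -⟩ := mem_isoPoints.1 hu'
  obtain ⟨rfl, rfl⟩ := lead_unique (x := fun i => u i • a + v i • b) ha ha'
    (combo_apply_lead hij hu hv a b)
    ⟨(congrFun h i').trans (by simp [hi'.1]),
      fun k hk => (congrFun h k).trans (by simp [hi'.2 k hk])⟩
  have := congrFun h j
  simp only [huj, hv.1, zero_smul, zero_add, one_smul] at this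
  exact hb _ this

/-- The echelon form lets `x` determine `a` and `b` as its first nonzero entry and its first entry
outside `𝔽₃ a`; independence then determines `u` and `v`. -/
theorem line_param_injective {u v u' v' : Fin 5 → ZMod 3} (h₁ : (u, v) ∈ isoLines)
    (h₂ : (u', v') ∈ isoLines) {a b a' b' : F} (ha : a ≠ 0) (hb : ∀ s : ZMod 3, b ≠ s • a)
    (ha' : a' ≠ 0) (hb' : ∀ s : ZMod 3, b' ≠ s • a')
    (h : (fun i => u i • a + v i • b) = fun i => u' i • a' + v' i • b') :
    u = u' ∧ v = v' ∧ a = a' ∧ b = b' := by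
  obtain ⟨⟨i, j, hij, hu, hv, huj⟩, -⟩ := mem_isoLines.1 h₁
  obtain ⟨⟨i', j', hij', hu', hv', huj'⟩, -⟩ := mem_isoLines.1 h₂
  have hlead := combo_apply_lead hij' hu' hv' a' b'
  obtain ⟨rfl, rfl⟩ := lead_unique (x := fun i => u i • a + v i • b) ha ha'
    (combo_apply_lead hij hu hv a b)
    ⟨(congrFun h i').trans hlead.1, fun k hk => (congrFun h k).trans (hlead.2 k hk)⟩
  have hxj : u j • a + v j • b = b := by simp [huj, hv.1]
  have hxj' : u' j' • a + v' j' • b' = b' := by simp [huj', hv'.1]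
  obtain rfl : j = j' := first_unique (p := fun k => ∀ s : ZMod 3, u k • a + v k • b ≠ s • a)
    (by rwa [hxj]) (fun k hk hn => hn (u k) (by simp [hv.2 k hk]))
    (by rw [congrFun h j', hxj']; exact hb')
    (fun k hk hn => hn (u' k) (by rw [congrFun h k]; simp [hv'.2 k hk]))
  obtain rfl : b = b' := by rw [← hxj, ← hxj', congrFun h j]
  have key (k) := combo_injective ha hb (congrFun h k)
  exact ⟨funext fun k => (key k).1, funext fun k => (key k).2, rfl, rfl⟩

end Classification

/-! ### Counting the solutions -/

section Count

variable {F : Type*} [Field F] [Fintype F] [DecidableEq F] [Algebra (ZMod 3) F]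

/-- The ordered pairs of elements of `F` that are linearly independent over `𝔽₃`. -/
def indepPairs (F : Type*) [Field F] [Fintype F] [DecidableEq F] [Algebra (ZMod 3) F] :
    Finset (Σ _ : F, F) :=
  (univ.erase 0).sigma fun a => univ \ univ.image fun s : ZMod 3 => s • a

theorem mem_indepPairs {w : Σ _ : F, F} :
    w ∈ indepPairs F ↔ w.1 ≠ 0 ∧ ∀ s : ZMod 3, w.2 ≠ s • w.1 := by
  simp [indepPairs, eq_comm]

theorem card_indepPairs :
    (#(indepPairs F) : ℤ) = (Fintype.card F - 1) * (Fintype.card F - 3) := by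
  have h (a : F) (ha : a ∈ univ.erase (0 : F)) :
      (#(univ \ univ.image fun s : ZMod 3 => s • a) : ℤ) = Fintype.card F - 3 := by
    rw [cast_card_sdiff (subset_univ _),
      card_image_of_injective _ (smul_left_injective _ (ne_of_mem_erase ha))]
    simp [ZMod.card]
  rw [indepPairs, card_sigma, Nat.cast_sum, sum_congr rfl h, sum_const, nsmul_eq_mul,
    cast_card_erase_of_mem (mem_univ _), card_univ]

theorem card_solutionSet :
    (M5 3 F : ℤ) = 1 + 40 * (Fintype.card F - 1) +
      40 * ((Fintype.card F - 1) * (Fintype.card F - 3)) := by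
  let f : (Fin 5 → ZMod 3) × F → Fin 5 → F := fun w i => w.1 i • w.2
  let g : ((Fin 5 → ZMod 3) × (Fin 5 → ZMod 3)) × (Σ _ : F, F) → Fin 5 → F :=
    fun w i => w.1.1 i • w.2.1 + w.1.2 i • w.2.2
  let A := (isoPoints ×ˢ univ.erase (0 : F)).image f
  let B := (isoLines ×ˢ indepPairs F).image g
  have hA : (#A : ℤ) = 40 * (Fintype.card F - 1) := by
    rw [card_image_of_injOn, card_product, card_isoPoints, Nat.cast_mul,
      cast_card_erase_of_mem (mem_univ _), card_univ]
    · rfl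
    · rintro ⟨u, a⟩ h ⟨u', a'⟩ h' e
      simp only [coe_product, Set.mem_prod, mem_coe, mem_erase, mem_univ, and_true] at h h'
      exact Prod.ext_iff.2 (point_param_injective h.1 h'.1 h.2 h'.2 e)
  have hB : (#B : ℤ) = 40 * ((Fintype.card F - 1) * (Fintype.card F - 3)) := by
    rw [card_image_of_injOn, card_product, card_isoLines, Nat.cast_mul, card_indepPairs]
    · rfl
    · rintro ⟨⟨u, v⟩, a, b⟩ h ⟨⟨u', v'⟩, a', b'⟩ h' e
      simp only [coe_product, Set.mem_prod, mem_coe, mem_indepPairs] at h h'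
      obtain ⟨rfl, rfl, rfl, rfl⟩ := line_param_injective h.1 h'.1 h.2.1 h.2.2 h'.2.1 h'.2.2 e
      rfl
  have memA {x : Fin 5 → F} :
      x ∈ A ↔ ∃ u ∈ isoPoints, ∃ a : F, a ≠ 0 ∧ x = fun i => u i • a := by
    simp only [A, mem_image, mem_product, mem_erase, mem_univ, and_true, Prod.exists, f]
    constructor
    · rintro ⟨u, a, ⟨hu, ha⟩, rfl⟩; exact ⟨u, hu, a, ha, rfl⟩
    · rintro ⟨u, hu, a, ha, rfl⟩; exact ⟨u, a, ⟨hu, ha⟩, rfl⟩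
  have memB {x : Fin 5 → F} :
      x ∈ B ↔ ∃ u v, (u, v) ∈ isoLines ∧ ∃ a b : F, a ≠ 0 ∧ (∀ s : ZMod 3, b ≠ s • a) ∧
        x = fun i => u i • a + v i • b := by
    simp only [B, mem_image, mem_product, mem_indepPairs, Prod.exists, Sigma.exists, g]
    constructor
    · rintro ⟨u, v, a, b, ⟨hu, ha, hb⟩, rfl⟩; exact ⟨u, v, hu, a, b, ha, hb, rfl⟩
    · rintro ⟨u, v, hu, a, b, ha, hb, rfl⟩; exact ⟨u, v, a, b, ⟨hu, ha, hb⟩, rfl⟩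
  have hsol : solutionSet 3 F = ↑(insert 0 (A ∪ B)) := by
    ext x
    simp only [coe_insert, coe_union, Set.mem_insert_iff, Set.mem_union, mem_coe, memA, memB]
    refine ⟨solution_cases, ?_⟩
    rintro (rfl | ⟨u, hu, a, -, rfl⟩ | ⟨u, v, huv, a, b, -, -, rfl⟩)
    · simp [mem_solutionSet]
    · simpa using combo_mem_solutionSet (v := 0) (mem_isoPoints.1 hu).2 (by simp) (by simp) a 0
    · obtain ⟨-, h1, h2, h3⟩ := mem_isoLines.1 huv
      exact combo_mem_solutionSet h1 h2 h3 a b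
  have h0 : (0 : Fin 5 → F) ∉ A ∪ B := by
    rw [mem_union, memA, memB]
    rintro (⟨u, hu, a, ha, h⟩ | ⟨u, v, huv, a, b, ha, hb, h⟩)
    · obtain ⟨⟨i, hi⟩, -⟩ := mem_isoPoints.1 hu
      have := congrFun h i
      simp only [hi.1, one_smul, Pi.zero_apply] at this
      exact ha this.symm
    · obtain ⟨⟨i, j, hij, hu, hv, -⟩, -⟩ := mem_isoLines.1 huv
      have := congrFun h i
      simp only [(combo_apply_lead hij hu hv a b).1, Pi.zero_apply] at this
      exact ha this.symm
  have hAB : Disjoint A B := by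
    rw [disjoint_left]
    intro x hxA hxB
    obtain ⟨u, hu, a, ha, rfl⟩ := memA.1 hxA
    obtain ⟨u', v', huv', a', b', ha', hb', h⟩ := memB.1 hxB
    exact line_param_ne_point_param huv' hu ha' hb' ha h.symm
  rw [M5, hsol, Set.ncard_coe_finset, card_insert_of_notMem h0, card_union_of_disjoint hAB]
  push_cast
  rw [hA, hB]
  ring

end Count

theorem lemma13 (p m : ℕ) (hp : p = 3) (F : Type*) [Field F] [Fintype F] [Algebra (ZMod p) F]
    (hF : Fintype.card F = p ^ m) :
    (M5 p F : ℤ) = 5 * ((p : ℤ) ^ m - 1) * (8 * (p : ℤ) ^ m - 2 * (p : ℤ) - 10) + 1 ∧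
      ∑ α : F, ∑ β : F, ∑ γ : F, expSum p α β γ ^ 5 = (M5 p F : ℂ) * (p : ℂ) ^ (3 * m) := by
  classical
  subst hp
  constructor
  -- At `p = 3` both sides are `1 + 40(q - 1)(q - 2)`.
  · rw [card_solutionSet, hF]
    push_cast
    ring
  · rw [sum_expSum_pow_five, hF, Nat.cast_pow, ← pow_mul, mul_comm m 3]
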